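/- All digraphs are finite and are orientations of simple graphs (no loops, no multiple arcs, no pair of opposite arcs); the chromatic number $\chi$ of a digraph is that of its underlying graph. For $k\ge 1$, let $C(k,1,1,1,1,1)$ be the oriented cycle formed of six blocks (maximal directed subpaths) of lengths $k,1,1,1,1,1$. A subdivision of a digraph $H$ is obtained by replacing each arc $(x,y)$ of $H$ by a directed path from $x$ to $y$ of length at least $1$, the new paths being internally disjoint. Let $D$ be a digraph that contains no subdivision of $C(k,1,1,1,1,1)$ as a subdigraph, and let $T$ be a spanning out-tree of $D$ with source $r$ (a spanning subdigraph whose underlying graph is a tree, in which every vertex has in-degree at most $1$ and $r$ has in-degree $0$). For a vertex $x$, let $l_T(x)$ be the number of vertices of the unique directed path of $T$ from $r$ to $x$, and write $y\leqslant_T x$ if $y$ lies on this path. Suppose that $T$ is final, that is, $y\leqslant_T x$ for every arc $(x,y)$ of $D$ with $l_T(x)\ge l_T(y)$. For $1\le i\le k$, let $D_i$ be the subdigraph of $D$ induced by $V_i=\{x : l_T(x)=i+\alpha k \text{ for some integer } \alpha\ge 0\}$, and let $D_i^3$ be the spanning subdigraph of $D_i$ whose arcs are the arcs $(x,y)$ of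 $D_i$ that satisfy neither ($l_T(x)<l_T(y)$ and $x\leqslant_T y$) nor ($l_T(x)>l_T(y)$ and $y\leqslant_T x$). Then $\chi(D_i^3)\le 24$ for all $i\in\{1,2,\dots,k\}$. -/

import Mathlib

namespace SixBlocks

/-- A digraph obtained by giving one orientation to each edge of a simple graph:
no loops and no pair of opposite arcs. -/
def IsOriented {V : Type*} (D : Digraph V) : Prop :=
  ∀ x y, D.Adj x y → ¬ D.Adj y x

/-- The chromatic number of a digraph is that of its underlying simple graph. -/
noncomputable def chi {V : Type*} (D : Digraph V) : ℕ∞ :=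
  D.toSimpleGraphInclusive.chromaticNumber

/-- `p` is the list of vertices of a directed path of `D` from `x` to `y`. -/
structure IsDipath {V : Type*} (D : Digraph V) (x y : V) (p : List V) : Prop where
  chain : p.IsChain D.Adj
  nodup : p.Nodup
  head : p.head? = some x
  last : p.getLast? = some y

/-- The internal vertices of a path given by its list of vertices. -/
def internalVertices {V : Type*} (p : List V) : List V := p.tail.dropLast

/-- `D` contains a subdivision of the loopless digraph `H`: `φ` places the vertices of `H`, and each
arc `(u, v)` of `H` is replaced by a directed path `P u v` of `D` from `φ u` to `φ v`, of length at
least `1`, whose internal vertices are new and lie on no other of these paths. -/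
def ContainsSubdivision {W V : Type*} (H : Digraph W) (D : Digraph V) : Prop :=
  ∃ (φ : W → V) (P : W → W → List V),
    Function.Injective φ ∧
    (∀ u v, H.Adj u v → IsDipath D (φ u) (φ v) (P u v) ∧ 2 ≤ (P u v).length) ∧
    (∀ u v, H.Adj u v → ∀ w, φ w ∉ internalVertices (P u v)) ∧
    (∀ u v u' v', H.Adj u v → H.Adj u' v' → (u, v) ≠ (u', v') →
      ∀ z, z ∈ internalVertices (P u v) → z ∉ internalVertices (P u' v'))

/-- The directions of the successive edges met when going round a cycle with blocks of the given
lengths: the first block has direction `b`, and the directions of the blocks alternate. -/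
def blockDirections : Bool → List ℕ → List Bool
  | _, [] => []
  | b, m :: ks => List.replicate m b ++ blockDirections (!b) ks

/-- The oriented cycle `C(k₁, …, kₙ)` (for `n` even and positive `kᵢ`) on the vertices
`0, 1, …, k₁ + ⋯ + kₙ - 1`, taken modulo their number. The `j`-th edge joins `j` and `j + 1`; it is
the arc `(j, j + 1)` in the blocks of odd rank and `(j + 1, j)` in the blocks of even rank. -/
def blockCycle (ks : List ℕ) : Digraph (ZMod ks.sum) where
  Adj a b := ∃ j : ℕ,
    ((blockDirections true ks)[j]? = some true ∧ a = (j : ZMod ks.sum) ∧ b = (j : ZMod ks.sum) + 1) ∨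
    ((blockDirections true ks)[j]? = some false ∧ a = (j : ZMod ks.sum) + 1 ∧ b = (j : ZMod ks.sum))

/-- `T` is an out-tree with source `r` and vertex set `V`. -/
structure IsOutTree {V : Type*} (T : Digraph V) (r : V) : Prop where
  oriented : IsOriented T
  tree : T.toSimpleGraphInclusive.IsTree
  indegree_le_one : ∀ x y z, T.Adj x z → T.Adj y z → x = y
  source : ∀ x, ¬ T.Adj x r

/-- `T` is a spanning out-tree of `D` with source `r`. -/
def IsSpanningOutTree {V : Type*} (D T : Digraph V) (r : V) : Prop :=
  IsOutTree T r ∧ T ≤ D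

/-- The level of `x`: the number of vertices of the (unique) directed path of `T` from `r` to `x`. -/
noncomputable def level {V : Type*} (T : Digraph V) (r x : V) : ℕ :=
  sInf {n | ∃ p, IsDipath T r x p ∧ p.length = n}

/-- `y` is an ancestor of `x` in `T`: it lies on the directed path of `T` from `r` to `x`. -/
def IsAncestor {V : Type*} (T : Digraph V) (r y x : V) : Prop :=
  ∃ p, IsDipath T r x p ∧ y ∈ p

/-- `T` is a final out-tree of `D`: every backward arc of `D` goes to an ancestor. -/
def IsFinal {V : Type*} (D T : Digraph V) (r : V) : Prop :=
  ∀ x y, D.Adj x y → ¬ level T r x < level T r y → IsAncestor T r y x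

/-- The vertex class `V_i`: the union of the levels `i + α k` for `α ≥ 0`. -/
def levelClass {V : Type*} (T : Digraph V) (r : V) (k i : ℕ) : Set V :=
  {x | ∃ α : ℕ, level T r x = i + α * k}

/-- The subdigraph of `D` induced by a set of vertices. -/
def induced {V : Type*} (D : Digraph V) (S : Set V) : Digraph S where
  Adj x y := D.Adj x y

/-- The subdigraph `D_i` of `D` induced by `V_i`. -/
def classDigraph {V : Type*} (D T : Digraph V) (r : V) (k i : ℕ) :
    Digraph (levelClass T r k i) :=
  induced D (levelClass T r k i)

/-- The spanning subdigraph `D_i^1` of `D_i`: the arcs from an ancestor to a vertex of higher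
level. -/
def classDigraph₁ {V : Type*} (D T : Digraph V) (r : V) (k i : ℕ) :
    Digraph (levelClass T r k i) where
  Adj x y := (classDigraph D T r k i).Adj x y ∧
    level T r x < level T r y ∧ IsAncestor T r x y

/-- The spanning subdigraph `D_i^2` of `D_i`: the arcs to an ancestor of lower level. -/
def classDigraph₂ {V : Type*} (D T : Digraph V) (r : V) (k i : ℕ) :
    Digraph (levelClass T r k i) where
  Adj x y := (classDigraph D T r k i).Adj x y ∧
    level T r y < level T r x ∧ IsAncestor T r y x

/-- The spanning subdigraph `D_i^3` of `D_i`: the arcs of `D_i` that are neither in `D_i^1` nor in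
`D_i^2`. -/
def classDigraph₃ {V : Type*} (D T : Digraph V) (r : V) (k i : ℕ) :
    Digraph (levelClass T r k i) where
  Adj x y := (classDigraph D T r k i).Adj x y ∧
    ¬ ((classDigraph₁ D T r k i).Adj x y ∨ (classDigraph₂ D T r k i).Adj x y)

end SixBlocks

namespace SixBlocks

/-! ### Root paths, ancestors and last common ancestors in an out-tree. -/

section RootPaths

variable {V : Type*} {D T : Digraph V} {r : V}

/-! By finality, an arc of `D_i^3` goes from a lower to a higher level, between vertices
incomparable in `T`. Fix a depth-first preorder of `T`, and a second one with all sibling orders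
reversed. Incomparable vertices are ordered oppositely by the two, so each arc goes forward in one
of them.

For a fixed preorder, a vertex set `S` spans at most `4 * #S` forward arcs. Otherwise, repeated
deletion of extremal arcs leaves an antidirected path with arcs `c₁y₁`, `c₂y₁`, `c₂y₂`, `c₃y₂`,
`c₃y₃` and order `c₁ < c₂ < c₃ < y₃ < y₂ < y₁` (`exists_nested_antidirected_path`). Tree paths close
it into a subdivision of `C(k,1,1,1,1,1)`: the descendants of a vertex form an interval of the
preorder, which keeps the paths disjoint, and distinct levels of one class differ by at least `k`,
which makes one block long. The two cases are `containsSubdivision_of_isAncestor` and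
`containsSubdivision_of_not_isAncestor`.

Hence `S` spans at most `8 * #S` arcs, the graph is 16-degenerate, and 17 colours suffice. -/

theorem IsDipath.mono {D' : Digraph V} (hle : D ≤ D') {x y : V} {p : List V}
    (h : IsDipath D x y p) : IsDipath D' x y p :=
  ⟨h.chain.imp fun _ _ hab => hle hab, h.nodup, h.head, h.last⟩

theorem IsDipath.eq_concat {x y : V} {p : List V} (h : IsDipath D x y p) : ∃ q, p = q ++ [y] := by
  have := h.last
  rw [List.getLast?_eq_some_iff] at this
  exact this

theorem IsDipath.split {x y z : V} {p : List V} (h : IsDipath D x y p) (hz : z ∈ p) :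
    ∃ s t, p = s ++ z :: t ∧ IsDipath D x z (s ++ [z]) ∧ IsDipath D z y (z :: t) := by
  obtain ⟨s, t, rfl⟩ := List.append_of_mem hz
  refine ⟨s, t, rfl, ⟨?_, ?_, ?_, by simp⟩, ⟨?_, ?_, by simp, ?_⟩⟩
  · exact h.chain.prefix ⟨t, by simp⟩
  · exact h.nodup.sublist (List.IsPrefix.sublist ⟨t, by simp⟩)
  · have := h.head
    cases s <;> simpa using this
  · exact h.chain.suffix ⟨s, rfl⟩
  · exact h.nodup.sublist (List.IsSuffix.sublist ⟨s, rfl⟩)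
  · have := h.last
    rwa [List.getLast?_append_of_ne_nil _ (by simp)] at this

theorem IsDipath.concat {x y z : V} {p : List V} (h : IsDipath D x y p) (hyz : D.Adj y z)
    (hz : z ∉ p) : IsDipath D x z (p ++ [z]) := by
  refine ⟨?_, ?_, ?_, by simp⟩
  · refine List.isChain_append.2 ⟨h.chain, by simp, ?_⟩
    intro a ha b hb
    rw [h.last] at ha
    simp only [List.head?_cons, Option.mem_def, Option.some.injEq] at ha hb
    exact ha ▸ hb ▸ hyz
  · rw [List.nodup_append]
    refine ⟨h.nodup, by simp, ?_⟩
    rintro a ha b hb rfl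
    rw [List.mem_singleton] at hb
    exact hz (hb ▸ ha)
  · rw [List.head?_append, h.head]; rfl

/-- Follow an undirected walk from `r`. A step along an arc extends the path; a step against an arc
reaches the unique in-neighbour, which is already on the path. -/
theorem IsOutTree.exists_isDipath (hT : IsOutTree T r) (x : V) : ∃ p, IsDipath T r x p := by
  have h := hT.tree.connected.preconnected r x
  rw [SimpleGraph.reachable_iff_reflTransGen] at h
  induction h with
  | refl => exact ⟨[r], by simp, by simp, by simp, by simp⟩
  | @tail y z _ hyz ih =>
    obtain ⟨p, hp⟩ := ih
    by_cases hz : z ∈ p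
    · obtain ⟨s, t, -, hs, -⟩ := hp.split hz
      exact ⟨_, hs⟩
    rw [Digraph.toSimpleGraphInclusive, SimpleGraph.fromRel_adj] at hyz
    rcases hyz.2 with hyz | hzy
    · exact ⟨_, hp.concat hyz hz⟩
    · exfalso
      obtain ⟨q, rfl⟩ := hp.eq_concat
      rcases List.eq_nil_or_concat' q with rfl | ⟨q, a, rfl⟩
      · have hy : y = r := by simpa using hp.head
        exact hT.source z (hy ▸ hzy)
      · have hay : T.Adj a y := by
          have := hp.chain.suffix (l₁ := [a, y]) ⟨q, by simp⟩
          simpa using this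
        exact hz (by simp [hT.indegree_le_one _ _ _ hzy hay])

/-- Read backwards from `x`, the path is forced: in-degrees are at most 1, and only at `r`, which
has no in-neighbour, can it stop. -/
theorem IsOutTree.isDipath_unique (hT : IsOutTree T r) {x : V} {p q : List V}
    (hp : IsDipath T r x p) (hq : IsDipath T r x q) : p = q := by
  induction p using List.reverseRecOn generalizing x q with
  | nil => simpa using hp.head
  | append_singleton p a ih =>
    obtain rfl : a = x := by simpa using hp.last
    obtain ⟨q, rfl⟩ := hq.eq_concat
    have key : ∀ l b, IsDipath T r a ((l ++ [b]) ++ [a]) → T.Adj b a ∧ IsDipath T r b (l ++ [b]) := by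
      intro l b h
      constructor
      · simpa using h.chain.suffix (l₁ := [b, a]) ⟨l, by simp⟩
      · obtain ⟨s, t, hst, hs, -⟩ := h.split (z := b) (by simp)
        have hnd := h.nodup
        have : s = l := by
          have h1 : l ++ b :: [a] = s ++ b :: t := by simpa using hst
          have hnd' : (l ++ b :: [a]).Nodup := by simpa using hnd
          rcases List.append_eq_append_iff.1 h1 with ⟨u, hu, hu'⟩ | ⟨u, hu, hu'⟩
          · cases u with
            | nil => simpa using hu
            | cons c u =>
              simp only [List.cons_append, List.cons.injEq] at hu'
              obtain ⟨rfl, hu'⟩ := hu'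
              exfalso
              have : b ∈ [a] := by rw [hu']; simp
              rw [List.nodup_append] at hnd'
              exact (List.nodup_cons.1 hnd'.2.1).1 this
          · cases u with
            | nil => simpa using hu.symm
            | cons c u =>
              simp only [List.cons_append, List.cons.injEq] at hu'
              obtain ⟨rfl, hu'⟩ := hu'
              exfalso
              rw [List.nodup_append] at hnd'
              exact hnd'.2.2 b (by rw [hu]; simp) b (by simp) rfl
        exact this ▸ hs
    have nokey : ∀ l b, IsDipath T r a ([] ++ [a]) → IsDipath T r a ((l ++ [b]) ++ [a]) → False := by
      intro l b h h'
      obtain rfl : a = r := by simpa using h.head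
      exact hT.source b (key l b h').1
    rcases List.eq_nil_or_concat' p with rfl | ⟨p, b, rfl⟩ <;>
      rcases List.eq_nil_or_concat' q with rfl | ⟨q, c, rfl⟩
    · rfl
    · exact (nokey q c hp hq).elim
    · exact (nokey p b hq hp).elim
    · obtain ⟨hb, hp'⟩ := key p b hp
      obtain ⟨hc, hq'⟩ := key q c hq
      obtain rfl := hT.indegree_le_one _ _ _ hb hc
      rw [ih hp' hq']

open Classical in
/-- The list of vertices of the directed path of `T` from `r` to `x`. -/
noncomputable def rootPath (T : Digraph V) (r x : V) : List V :=
  if h : ∃ p, IsDipath T r x p then h.choose else []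

theorem IsOutTree.isDipath_rootPath (hT : IsOutTree T r) (x : V) :
    IsDipath T r x (rootPath T r x) := by
  rw [rootPath, dif_pos (hT.exists_isDipath x)]
  exact (hT.exists_isDipath x).choose_spec

theorem IsOutTree.eq_rootPath (hT : IsOutTree T r) {x : V} {p : List V} (hp : IsDipath T r x p) :
    p = rootPath T r x :=
  hT.isDipath_unique hp (hT.isDipath_rootPath x)

theorem IsOutTree.rootPath_injective (hT : IsOutTree T r) :
    Function.Injective (rootPath T r) := by
  intro x y h
  have hx := (hT.isDipath_rootPath x).last
  rw [h, (hT.isDipath_rootPath y).last] at hx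
  exact (Option.some.inj hx).symm

theorem IsOutTree.level_eq (hT : IsOutTree T r) (x : V) :
    level T r x = (rootPath T r x).length := by
  have : {n | ∃ p, IsDipath T r x p ∧ p.length = n} = {(rootPath T r x).length} := by
    ext n
    constructor
    · rintro ⟨p, hp, rfl⟩
      rw [hT.eq_rootPath hp]; rfl
    · rintro rfl
      exact ⟨_, hT.isDipath_rootPath x, rfl⟩
  rw [level, this, csInf_singleton]

theorem IsOutTree.isAncestor_iff_mem (hT : IsOutTree T r) {a x : V} :
    IsAncestor T r a x ↔ a ∈ rootPath T r x := by
  constructor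
  · rintro ⟨p, hp, ha⟩
    rwa [← hT.eq_rootPath hp]
  · exact fun h => ⟨_, hT.isDipath_rootPath x, h⟩

theorem IsOutTree.isAncestor_iff (hT : IsOutTree T r) {a x : V} :
    IsAncestor T r a x ↔ rootPath T r a <+: rootPath T r x := by
  rw [hT.isAncestor_iff_mem]
  constructor
  · intro h
    obtain ⟨s, t, hst, hs, -⟩ := (hT.isDipath_rootPath x).split h
    rw [← hT.eq_rootPath hs, hst]
    exact ⟨t, by simp⟩
  · intro h
    exact h.subset (List.mem_of_getLast? (hT.isDipath_rootPath a).last)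

theorem IsOutTree.isAncestor_refl (hT : IsOutTree T r) (x : V) : IsAncestor T r x x :=
  hT.isAncestor_iff.2 List.prefix_rfl

theorem IsOutTree.isAncestor_trans (hT : IsOutTree T r) {a b x : V}
    (hab : IsAncestor T r a b) (hbx : IsAncestor T r b x) : IsAncestor T r a x :=
  hT.isAncestor_iff.2 ((hT.isAncestor_iff.1 hab).trans (hT.isAncestor_iff.1 hbx))

theorem IsOutTree.level_le (hT : IsOutTree T r) {a x : V} (h : IsAncestor T r a x) :
    level T r a ≤ level T r x := by
  rw [hT.level_eq, hT.level_eq]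
  exact (hT.isAncestor_iff.1 h).length_le

theorem IsOutTree.eq_of_level_le (hT : IsOutTree T r) {a x : V} (h : IsAncestor T r a x)
    (hle : level T r x ≤ level T r a) : a = x := by
  rw [hT.level_eq, hT.level_eq] at hle
  exact hT.rootPath_injective ((hT.isAncestor_iff.1 h).eq_of_length_le hle)

theorem IsOutTree.isAncestor_antisymm (hT : IsOutTree T r) {a x : V} (h : IsAncestor T r a x)
    (h' : IsAncestor T r x a) : a = x :=
  hT.eq_of_level_le h (hT.level_le h')

/-- The path of `T` from an ancestor `a` to `x`, given by its vertices after `a`. -/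
theorem IsOutTree.exists_segment (hT : IsOutTree T r) {a x : V} (h : IsAncestor T r a x) :
    ∃ l, IsDipath T a x (a :: l) ∧ level T r a + l.length = level T r x ∧
      ∀ v ∈ l, IsAncestor T r a v ∧ IsAncestor T r v x ∧ v ≠ a := by
  obtain ⟨s, t, hst, hs, ht⟩ := (hT.isDipath_rootPath x).split (hT.isAncestor_iff_mem.1 h)
  refine ⟨t, ht, ?_, ?_⟩
  · rw [hT.level_eq, hT.level_eq, ← hT.eq_rootPath hs, hst]
    simp only [List.length_append, List.length_cons, List.length_nil]
    omega
  · intro v hv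
    have hvx : IsAncestor T r v x := hT.isAncestor_iff_mem.2 (by rw [hst]; simp [hv])
    have hva : v ≠ a := by
      rintro rfl
      exact (List.nodup_cons.1 ht.nodup).1 hv
    refine ⟨?_, hvx, hva⟩
    rcases List.prefix_or_prefix_of_prefix (hT.isAncestor_iff.1 h) (hT.isAncestor_iff.1 hvx)
      with h1 | h1
    · exact hT.isAncestor_iff.2 h1
    · exfalso
      have h2 := hT.isAncestor_iff_mem.1 (hT.isAncestor_iff.2 h1)
      rw [← hT.eq_rootPath hs] at h2
      have h3 := (hT.isDipath_rootPath x).nodup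
      rw [hst, List.nodup_append] at h3
      rcases List.mem_append.1 h2 with h4 | h4
      · exact h3.2.2 v h4 v (by simp [hv]) rfl
      · exact hva (by simpa using h4)

/-- The ancestors of `x` form a chain, so the common ancestor of highest level lies below all the
others. -/
theorem IsOutTree.exists_meet (hT : IsOutTree T r) (x y : V) :
    ∃ z, IsAncestor T r z x ∧ IsAncestor T r z y ∧
      ∀ v, IsAncestor T r v x → IsAncestor T r v y → IsAncestor T r v z := by
  have hr : ∀ x, IsAncestor T r r x := fun x =>
    hT.isAncestor_iff_mem.2 (List.mem_of_head? (hT.isDipath_rootPath x).head)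
  let S : Set V := {v | IsAncestor T r v x ∧ IsAncestor T r v y}
  have hfin : S.Finite := (List.finite_toSet (rootPath T r x)).subset
    fun v hv => hT.isAncestor_iff_mem.1 hv.1
  obtain ⟨z, hz, hmax⟩ := Set.exists_max_image S (level T r) hfin ⟨r, hr x, hr y⟩
  refine ⟨z, hz.1, hz.2, fun v hvx hvy => ?_⟩
  rcases List.prefix_or_prefix_of_prefix (hT.isAncestor_iff.1 hvx) (hT.isAncestor_iff.1 hz.1)
    with h1 | h1
  · exact hT.isAncestor_iff.2 h1
  · rw [← hT.isAncestor_iff] at h1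
    rw [hT.eq_of_level_le h1 (hmax v ⟨hvx, hvy⟩)]
    exact hT.isAncestor_refl v

end RootPaths

end SixBlocks

namespace SixBlocks

/-! ### Recognising a subdivision of the six-block cycle. -/

section Subdivision

theorem blockDirections_sixBlocks (k : ℕ) : blockDirections true [k, 1, 1, 1, 1, 1] =
    List.replicate k true ++ [false, true, false, true, false] := by
  simp [blockDirections]

/-- The arcs of `C(k, 1, 1, 1, 1, 1)`, in terms of representatives of its vertices. -/
def IsSixBlockArc (k m n : ℕ) : Prop :=
  (m + 1 = n ∧ n ≤ k) ∨ (m = k + 1 ∧ n = k) ∨ (m = k + 1 ∧ n = k + 2) ∨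
    (m = k + 3 ∧ n = k + 2) ∨ (m = k + 3 ∧ n = k + 4) ∨ (m = 0 ∧ n = k + 4)

theorem isSixBlockArc_val {k n : ℕ} (hn : n = k + 5) {u v : ZMod n}
    (h : ∃ j : ℕ, ((List.replicate k true ++ [false, true, false, true, false])[j]? = some true ∧
        u = (j : ZMod n) ∧ v = (j : ZMod n) + 1) ∨
      ((List.replicate k true ++ [false, true, false, true, false])[j]? = some false ∧
        u = (j : ZMod n) + 1 ∧ v = (j : ZMod n))) :
    IsSixBlockArc k u.val v.val := by
  have hval : ∀ j : ℕ, j < k + 5 → (j : ZMod n).val = j := fun j hj =>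
    ZMod.val_natCast_of_lt (by rwa [hn])
  have hzero : ((k + 5 : ℕ) : ZMod n).val = 0 := by
    rw [← hn, ZMod.natCast_self, ZMod.val_zero]
  unfold IsSixBlockArc
  obtain ⟨j, h⟩ := h
  simp only [← Nat.cast_add_one] at h
  rcases lt_or_ge j k with hj | hj
  · rw [List.getElem?_append_left (by simpa using hj)] at h
    simp only [List.getElem?_replicate, hj, if_true, true_and, Option.some.injEq,
      Bool.true_eq_false, false_and, or_false] at h
    rw [h.1, h.2, hval _ (by omega), hval _ (by omega)]
    omega
  · rw [List.getElem?_append_right (by simpa using hj), List.length_replicate] at h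
    obtain ⟨i, rfl⟩ := Nat.exists_eq_add_of_le hj
    rw [Nat.add_sub_cancel_left] at h
    rcases i with _ | _ | _ | _ | _ | i
    · have h := h.resolve_left (by simp)
      rw [h.2.1, h.2.2, hval _ (by omega), hval _ (by omega)]; omega
    · have h := h.resolve_right (by simp)
      rw [h.2.1, h.2.2, hval _ (by omega), hval _ (by omega)]; omega
    · have h := h.resolve_left (by simp)
      rw [h.2.1, h.2.2, hval _ (by omega), hval _ (by omega)]; omega
    · have h := h.resolve_right (by simp)
      rw [h.2.1, h.2.2, hval _ (by omega), hval _ (by omega)]; omega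
    -- The last edge wraps around: `k + 5` is `0` modulo the number of vertices.
    · have h := h.resolve_left (by simp)
      have hzero' : ((k + (0 + 1 + 1 + 1 + 1) + 1 : ℕ) : ZMod n).val = 0 := hzero
      rw [h.2.1, h.2.2, hzero', hval _ (by omega)]; omega
    · simp at h

theorem isDipath_pair {V : Type*} {D : Digraph V} {x y : V} (h : D.Adj x y) (hne : x ≠ y) :
    IsDipath D x y [x, y] :=
  ⟨by simpa using h, by simpa using hne, by simp, by simp⟩

/-- Six internally disjoint directed paths that alternately share their ends and their starts, one of
them of length at least `k`, form a subdivision of any digraph with the arcs of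
`C(k, 1, 1, 1, 1, 1)`. -/
theorem containsSubdivision_of_isSixBlockArc {V : Type*} {D : Digraph V} {k n : ℕ}
    (hn : n = k + 5) {H : Digraph (ZMod n)}
    (hH : ∀ u v, H.Adj u v → IsSixBlockArc k u.val v.val) (hk : 1 ≤ k)
    (b : Fin 6 → V) (I : Fin 6 → List V) (hb : Function.Injective b)
    (hbI : ∀ i j, b i ∉ I j) (hI : ∀ i j, i ≠ j → ∀ z ∈ I i, z ∉ I j)
    (hlen : k ≤ (I 0).length + 1)
    (h0 : IsDipath D (b 0) (b 1) (b 0 :: I 0 ++ [b 1]))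
    (h1 : IsDipath D (b 2) (b 1) (b 2 :: I 1 ++ [b 1]))
    (h2 : IsDipath D (b 2) (b 3) (b 2 :: I 2 ++ [b 3]))
    (h3 : IsDipath D (b 4) (b 3) (b 4 :: I 3 ++ [b 3]))
    (h4 : IsDipath D (b 4) (b 5) (b 4 :: I 4 ++ [b 5]))
    (h5 : IsDipath D (b 0) (b 5) (b 0 :: I 5 ++ [b 5])) :
    ContainsSubdivision H D := by
  have : NeZero n := ⟨by omega⟩
  -- The entries of `L` are the images of `0, …, k + 4`. The long block uses the first `k` vertices
  -- of its path, then `b 1`; the vertices left over become internal to its last arc.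
  set L : List V := (b 0 :: I 0).take k ++ [b 1, b 2, b 3, b 4, b 5] with hL
  have htake : ((b 0 :: I 0).take k).length = k := by simp; omega
  have hLlen : L.length = k + 5 := by simp [hL, htake]
  have hnd0 : (b 0 :: I 0).Nodup := (List.nodup_append.1 h0.nodup).1
  have hLnd : L.Nodup := by
    rw [hL, List.nodup_append]
    refine ⟨hnd0.sublist (List.take_sublist _ _), by simp [hb.eq_iff], ?_⟩
    intro a ha c hc
    rcases List.mem_cons.1 (List.mem_of_mem_take ha) with rfl | ha
    · simp only [List.mem_cons, List.not_mem_nil, or_false] at hc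
      rcases hc with rfl | rfl | rfl | rfl | rfl <;> simp [hb.eq_iff]
    · rintro rfl
      simp only [List.mem_cons, List.not_mem_nil, or_false] at hc
      rcases hc with rfl | rfl | rfl | rfl | rfl <;> exact hbI _ _ ha
  have hlt : ∀ a : ZMod n, a.val < L.length := fun a => by
    rw [hLlen, ← hn]; exact ZMod.val_lt a
  set φ : ZMod n → V := fun a => L[a.val]'(hlt a) with hφ
  have hφlow : ∀ a (h : a.val < k), φ a = (b 0 :: I 0)[a.val]'(by simp; omega) := by
    intro a h
    simp only [hφ, hL]
    rw [List.getElem_append_left (by omega), List.getElem_take]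
  have hφhigh : ∀ a (j : ℕ) (hj : j < 5), a.val = k + j →
      φ a = [b 1, b 2, b 3, b 4, b 5][j]'(by simpa using hj) := by
    intro a j hj h
    simp only [hφ, hL]
    rw [List.getElem_append_right (by omega)]
    simp [htake, h]
  have hφ0 : ∀ a, a.val = 0 → φ a = b 0 := fun a h => by
    rw [hφlow a (by omega)]; simp [h]
  have hφ1 : ∀ a, a.val = k → φ a = b 1 := fun a h => hφhigh a 0 (by omega) h
  have hφ2 : ∀ a, a.val = k + 1 → φ a = b 2 := fun a h => hφhigh a 1 (by omega) h
  have hφ3 : ∀ a, a.val = k + 2 → φ a = b 3 := fun a h => hφhigh a 2 (by omega) h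
  have hφ4 : ∀ a, a.val = k + 3 → φ a = b 4 := fun a h => hφhigh a 3 (by omega) h
  have hφ5 : ∀ a, a.val = k + 4 → φ a = b 5 := fun a h => hφhigh a 4 (by omega) h
  let J : ℕ → ℕ → List V := fun m n =>
    if m + 1 = k ∧ n = k then (I 0).drop (k - 1) else
    if m = k + 1 ∧ n = k then I 1 else if m = k + 1 ∧ n = k + 2 then I 2 else
    if m = k + 3 ∧ n = k + 2 then I 3 else if m = k + 3 ∧ n = k + 4 then I 4 else
    if m = 0 ∧ n = k + 4 then I 5 else []
  let t : Fin 6 → ℕ × ℕ := ![(k - 1, k), (k + 1, k), (k + 1, k + 2), (k + 3, k + 2),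
    (k + 3, k + 4), (0, k + 4)]
  have hJ : ∀ m n z, z ∈ J m n → ∃ i, z ∈ I i ∧ (m, n) = t i ∧ (i = 0 → z ∈ (I 0).drop (k - 1)) := by
    intro m n z hz
    simp only [J] at hz
    split_ifs at hz with c0 c1 c2 c3 c4 c5
    · exact ⟨0, List.mem_of_mem_drop hz, by simp [t]; omega, fun _ => hz⟩
    · exact ⟨1, hz, by simp [t]; omega, by simp⟩
    · exact ⟨2, hz, by simp [t]; omega, by simp⟩
    · exact ⟨3, hz, by simp [t]; omega, by simp⟩
    · exact ⟨4, hz, by simp [t]; omega, by simp⟩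
    · exact ⟨5, hz, by simp [t]; omega, by simp⟩
    · simp at hz
  have hint : ∀ u v, internalVertices (φ u :: J u.val v.val ++ [φ v]) = J u.val v.val := by
    intro u v; simp [internalVertices]
  refine ⟨φ, fun u v => φ u :: J u.val v.val ++ [φ v], ?_, ?_, ?_, ?_⟩
  · intro a c h
    exact ZMod.val_injective _ ((hLnd.getElem_inj_iff).1 h)
  · intro u v huv
    refine ⟨?_, by simp⟩
    rcases hH u v huv with ⟨h, h'⟩ | ⟨h, h'⟩ | ⟨h, h'⟩ | ⟨h, h'⟩ | ⟨h, h'⟩ | ⟨h, h'⟩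
    · rcases h'.lt_or_eq with hv | hv
      · have hJe : J u.val v.val = [] := by
          simp only [J]
          split_ifs <;> first | rfl | omega
        simp only [hJe]
        have hne : φ u ≠ φ v := by
          intro he
          have := (hLnd.getElem_inj_iff).1 he
          omega
        refine isDipath_pair ?_ hne
        have hc := (List.isChain_append.1 h0.chain).1
        rw [List.isChain_iff_getElem] at hc
        have := hc u.val (by simp; omega)
        rw [hφlow u (by omega), hφlow v hv]
        simpa [h] using this
      · have hJe : J u.val v.val = (I 0).drop (k - 1) := by
          simp only [J]; rw [if_pos (by omega)]
        have hd : φ u :: (I 0).drop (k - 1) ++ [φ v] = (b 0 :: I 0 ++ [b 1]).drop (k - 1) := by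
          rw [List.drop_append_of_le_length (by simp; omega), hφ1 v hv, hφlow u (by omega)]
          congr 1
          rw [List.drop_eq_getElem_cons (l := b 0 :: I 0) (i := k - 1) (by simp; omega),
            List.drop_succ_cons]
          have : u.val = k - 1 := by omega
          simp [this]
        simp only [hJe]
        refine ⟨?_, ?_, by simp, List.getLast?_concat⟩
        · rw [hd]; exact h0.chain.suffix (List.drop_suffix _ _)
        · rw [hd]; exact h0.nodup.sublist (List.drop_sublist _ _)
    · have hJe : J u.val v.val = I 1 := by
        simp only [J]; split_ifs <;> first | rfl | omega
      simpa only [hJe, hφ2 u h, hφ1 v h'] using h1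
    · have hJe : J u.val v.val = I 2 := by
        simp only [J]; split_ifs <;> first | rfl | omega
      simpa only [hJe, hφ2 u h, hφ3 v h'] using h2
    · have hJe : J u.val v.val = I 3 := by
        simp only [J]; split_ifs <;> first | rfl | omega
      simpa only [hJe, hφ4 u h, hφ3 v h'] using h3
    · have hJe : J u.val v.val = I 4 := by
        simp only [J]; split_ifs <;> first | rfl | omega
      simpa only [hJe, hφ4 u h, hφ5 v h'] using h4
    · have hJe : J u.val v.val = I 5 := by
        simp only [J]; split_ifs <;> first | rfl | omega
      simpa only [hJe, hφ0 u h, hφ5 v h'] using h5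
  · intro u v _ w
    rw [hint]
    intro hw
    obtain ⟨i, hi, -, hi0⟩ := hJ _ _ _ hw
    have hwL : φ w ∈ L := List.getElem_mem _
    rw [hL, List.mem_append] at hwL
    rcases hwL with hwL | hwL
    · rcases List.mem_cons.1 (List.mem_of_mem_take hwL) with h | h
      · exact hbI 0 i (h ▸ hi)
      · by_cases hi' : i = 0
        · refine List.disjoint_take_drop hnd0 le_rfl hwL ?_
          have := hi0 hi'
          obtain ⟨k, rfl⟩ := Nat.exists_eq_add_of_le' hk
          simpa using this
        · exact hI i 0 hi' _ hi h
    · simp only [List.mem_cons, List.not_mem_nil, or_false] at hwL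
      rcases hwL with h | h | h | h | h <;> exact hbI _ i (h ▸ hi)
  · intro u v u' v' _ _ hne z hz hz'
    rw [hint] at hz hz'
    obtain ⟨i, hi, hti, -⟩ := hJ _ _ _ hz
    obtain ⟨j, hj, htj, -⟩ := hJ _ _ _ hz'
    by_cases hij : i = j
    · subst hij
      rw [← hti, Prod.mk.injEq] at htj
      exact hne (Prod.ext (ZMod.val_injective _ htj.1.symm) (ZMod.val_injective _ htj.2.symm))
    · exact hI i j hij z hi hj

/-- Six internally disjoint directed paths, alternately with the same end and the same start, form a
subdivision of `C(k, 1, 1, 1, 1, 1)` if one of them has length at least `k`. -/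
theorem containsSubdivision_blockCycle {V : Type*} {D : Digraph V} {k : ℕ} (hk : 1 ≤ k)
    (b : Fin 6 → V) (I : Fin 6 → List V) (hb : Function.Injective b)
    (hbI : ∀ i j, b i ∉ I j) (hI : ∀ i j, i ≠ j → ∀ z ∈ I i, z ∉ I j)
    (hlen : k ≤ (I 0).length + 1)
    (h0 : IsDipath D (b 0) (b 1) (b 0 :: I 0 ++ [b 1]))
    (h1 : IsDipath D (b 2) (b 1) (b 2 :: I 1 ++ [b 1]))
    (h2 : IsDipath D (b 2) (b 3) (b 2 :: I 2 ++ [b 3]))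
    (h3 : IsDipath D (b 4) (b 3) (b 4 :: I 3 ++ [b 3]))
    (h4 : IsDipath D (b 4) (b 5) (b 4 :: I 4 ++ [b 5]))
    (h5 : IsDipath D (b 0) (b 5) (b 0 :: I 5 ++ [b 5])) :
    ContainsSubdivision (blockCycle [k, 1, 1, 1, 1, 1]) D := by
  refine containsSubdivision_of_isSixBlockArc (by simp) (fun u v h => isSixBlockArc_val (by simp) ?_)
    hk b I hb hbI hI hlen h0 h1 h2 h3 h4 h5
  rw [← blockDirections_sixBlocks]
  exact h

end Subdivision

end SixBlocks

namespace SixBlocks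

/-! ### Degeneracy and dense ordered digraphs. -/

section Counting

open Finset

/-- Greedy colouring of a degenerate graph. -/
theorem colorable_of_forall_exists_card_le {V : Type*} [Finite V] {G : SimpleGraph V}
    [DecidableRel G.Adj] (d : ℕ)
    (h : ∀ S : Finset V, S.Nonempty → ∃ v ∈ S, #{w ∈ S | G.Adj v w} ≤ d) :
    G.Colorable (d + 1) := by
  classical
  have := Fintype.ofFinite V
  have key : ∀ S : Finset V, ∃ f : V → Fin (d + 1), ∀ u ∈ S, ∀ w ∈ S, G.Adj u w → f u ≠ f w := by
    intro S
    induction S using Finset.strongInduction with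
    | H S ih =>
      rcases S.eq_empty_or_nonempty with rfl | hS
      · exact ⟨fun _ => 0, by simp⟩
      obtain ⟨v, hv, hdeg⟩ := h S hS
      obtain ⟨f, hf⟩ := ih (S.erase v) (erase_ssubset hv)
      obtain ⟨c, hc⟩ : ∃ c, c ∉ image f {w ∈ S | G.Adj v w} := by
        by_contra! hall
        have h1 := card_le_card (fun c _ => hall c : (univ : Finset (Fin (d + 1))) ⊆ _)
        have h2 := card_image_le (s := {w ∈ S | G.Adj v w}) (f := f)
        rw [card_univ, Fintype.card_fin] at h1
        omega
      have hcv : ∀ w ∈ S, G.Adj v w → c ≠ f w := by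
        rintro w hw hvw rfl
        exact hc (mem_image.2 ⟨w, by simp [hw, hvw], rfl⟩)
      refine ⟨Function.update f v c, fun u hu w hw huw => ?_⟩
      by_cases huv : u = v
      · subst huv
        rw [Function.update_self, Function.update_of_ne huw.ne']
        exact hcv w hw huw
      by_cases hwv : w = v
      · subst hwv
        rw [Function.update_self, Function.update_of_ne huv]
        exact (hcv u hu huw.symm).symm
      · rw [Function.update_of_ne huv, Function.update_of_ne hwv]
        exact hf u (mem_erase.2 ⟨huv, hu⟩) w (mem_erase.2 ⟨hwv, hw⟩) huw
  obtain ⟨f, hf⟩ := key univ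
  exact ⟨SimpleGraph.Coloring.mk f fun {u w} huw => hf u (mem_univ _) w (mem_univ _) huw⟩

/-- A graph whose edges can be oriented so that each finite vertex set `S` spans at most `m * #S`
arcs is `2 * m + 1`-colourable. -/
theorem colorable_of_card_arcs_le {V : Type*} [Finite V] {G : SimpleGraph V} (R : V → V → Prop)
    [DecidableRel R] (hR : ∀ v w, G.Adj v w → R v w ∨ R w v) (m : ℕ)
    (h : ∀ S : Finset V, #{p ∈ S ×ˢ S | R p.1 p.2} ≤ m * #S) : G.Colorable (2 * m + 1) := by
  classical
  refine colorable_of_forall_exists_card_le (2 * m) fun S hS => ?_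
  by_contra! hlt
  have hdeg : ∀ v ∈ S, 2 * m + 1 ≤ #{w ∈ S | R v w} + #{w ∈ S | R w v} := by
    intro v hv
    refine (Nat.succ_le_of_lt (hlt v hv)).trans (le_trans (card_le_card ?_) (card_union_le _ _))
    intro w hw
    simp only [mem_union, mem_filter] at hw ⊢
    rcases hR v w hw.2 with h | h
    · exact Or.inl ⟨hw.1, h⟩
    · exact Or.inr ⟨hw.1, h⟩
  have hout : ∑ v ∈ S, #{w ∈ S | R v w} = #{p ∈ S ×ˢ S | R p.1 p.2} := by
    simp only [card_filter, sum_product]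
  have hin : ∑ v ∈ S, #{w ∈ S | R w v} = #{p ∈ S ×ˢ S | R p.1 p.2} := by
    simp only [card_filter, sum_product_right]
  have hsum := sum_le_sum hdeg
  simp only [sum_add_distrib, hout, hin, sum_const, smul_eq_mul] at hsum
  have := h S
  have hpos := hS.card_pos
  nlinarith

variable {V β : Type*} [DecidableEq V] [LinearOrder β] {key : V → β}

/-- The discarded arcs are those whose tail is largest among the arcs with the same head: at most
one per head. -/
theorem card_le_card_filter_snd (hkey : Function.Injective key) {S : Finset V}
    {A : Finset (V × V)} (hA : A ⊆ S ×ˢ S) :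
    #A ≤ #{p ∈ A | ∃ q ∈ A, q.2 = p.2 ∧ key p.1 < key q.1} + #S := by
  rw [← card_filter_add_card_filter_not (fun p => ∃ q ∈ A, q.2 = p.2 ∧ key p.1 < key q.1)]
  gcongr
  refine card_le_card_of_injOn Prod.snd (fun p hp => ?_) ?_
  · exact (mem_product.1 (hA (mem_filter.1 hp).1)).2
  · intro p hp q hq hpq
    simp only [coe_filter, Set.mem_ofPred_eq, not_exists, not_and, not_lt] at hp hq
    exact Prod.ext (hkey (le_antisymm (hq.2 p hp.1 hpq) (hp.2 q hq.1 hpq.symm))) hpq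

theorem card_le_card_filter_fst (hkey : Function.Injective key) {S : Finset V}
    {A : Finset (V × V)} (hA : A ⊆ S ×ˢ S) :
    #A ≤ #{p ∈ A | ∃ q ∈ A, q.1 = p.1 ∧ key q.2 < key p.2} + #S := by
  rw [← card_filter_add_card_filter_not (fun p => ∃ q ∈ A, q.1 = p.1 ∧ key q.2 < key p.2)]
  gcongr
  refine card_le_card_of_injOn Prod.fst (fun p hp => ?_) ?_
  · exact (mem_product.1 (hA (mem_filter.1 hp).1)).1
  · intro p hp q hq hpq
    simp only [coe_filter, Set.mem_ofPred_eq, not_exists, not_and, not_lt] at hp hq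
    exact Prod.ext hpq (hkey (le_antisymm (hp.2 q hq.1 hpq.symm) (hq.2 p hp.1 hpq)))

/-- A dense digraph on an ordered set contains an antidirected path whose successive sources
increase and whose successive sinks decrease. -/
theorem exists_nested_antidirected_path (hkey : Function.Injective key) {S : Finset V}
    {A : Finset (V × V)} (hA : A ⊆ S ×ˢ S) (hcard : 4 * #S < #A) :
    ∃ c₁ y₁ c₂ y₂ c₃ y₃, (c₁, y₁) ∈ A ∧ (c₂, y₁) ∈ A ∧ (c₂, y₂) ∈ A ∧ (c₃, y₂) ∈ A ∧
      (c₃, y₃) ∈ A ∧ key c₁ < key c₂ ∧ key c₂ < key c₃ ∧ key y₃ < key y₂ ∧ key y₂ < key y₁ := by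
  -- Four rounds of deletion, each costing at most `#S` arcs. A survivor `(c₁, y₁)` is then traced
  -- back through the rounds, each supplying the next arc of the path.
  have b₁ := card_le_card_filter_fst hkey hA
  set A₁ := {p ∈ A | ∃ q ∈ A, q.1 = p.1 ∧ key q.2 < key p.2} with hA₁
  have s₁ : A₁ ⊆ A := filter_subset _ _
  have b₂ := card_le_card_filter_snd hkey (s₁.trans hA)
  set A₂ := {p ∈ A₁ | ∃ q ∈ A₁, q.2 = p.2 ∧ key p.1 < key q.1} with hA₂
  have s₂ : A₂ ⊆ A₁ := filter_subset _ _
  have b₃ := card_le_card_filter_fst hkey (s₂.trans (s₁.trans hA))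
  set A₃ := {p ∈ A₂ | ∃ q ∈ A₂, q.1 = p.1 ∧ key q.2 < key p.2} with hA₃
  have s₃ : A₃ ⊆ A₂ := filter_subset _ _
  have b₄ := card_le_card_filter_snd hkey (s₃.trans (s₂.trans (s₁.trans hA)))
  set A₄ := {p ∈ A₃ | ∃ q ∈ A₃, q.2 = p.2 ∧ key p.1 < key q.1} with hA₄
  obtain ⟨⟨c₁, y₁⟩, h₄⟩ : A₄.Nonempty := card_pos.1 (by omega)
  obtain ⟨h₁, ⟨c₂, y₁'⟩, h₃, rfl, hc⟩ := mem_filter.1 h₄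
  obtain ⟨h₂, ⟨c₂', y₂⟩, h₂', rfl, hy⟩ := mem_filter.1 h₃
  obtain ⟨h₁', ⟨c₃, y₂'⟩, h₃', rfl, hc'⟩ := mem_filter.1 h₂'
  obtain ⟨h₀, ⟨c₃', y₃⟩, h₀', rfl, hy'⟩ := mem_filter.1 h₃'
  exact ⟨c₁, _, _, _, _, y₃, s₁ (s₂ (s₃ h₁)), s₁ (s₂ h₂), s₁ h₁', h₀, h₀', hc, hc', hy', hy⟩

end Counting

end SixBlocks

namespace SixBlocks

/-! ### Lexicographic order and prefixes. -/

section Lists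

variable {α : Type*} [LinearOrder α]

theorem prefix_of_le_of_le {a v w : List α} (haw : a <+: w) (hav : a ≤ v) (hvw : v ≤ w) :
    a <+: v := by
  induction a generalizing v w with
  | nil => exact List.nil_prefix
  | cons x a ih =>
    obtain ⟨t, rfl⟩ := haw
    cases v with
    | nil => exact absurd hav (not_le_of_gt (List.nil_lt_cons _ _))
    | cons y v =>
      rw [List.cons_append] at hvw
      have h1 := not_lt_of_ge hav
      have h2 := not_lt_of_ge hvw
      rw [List.cons_lt_cons_iff] at h1 h2
      push Not at h1 h2
      obtain rfl : x = y := le_antisymm h1.1 h2.1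
      obtain ⟨s, hs⟩ := ih ⟨t, rfl⟩ (h1.2 rfl) (h2.2 rfl)
      exact ⟨s, by rw [List.cons_append, hs]⟩

/-- The first entry where the lists differ decides, and dualising the alphabet reverses that
comparison. -/
theorem lt_or_map_toDual_lt {x y : List α} (hxy : ¬ x <+: y) (hyx : ¬ y <+: x) :
    x < y ∨ x.map OrderDual.toDual < y.map OrderDual.toDual := by
  induction x generalizing y with
  | nil => exact absurd List.nil_prefix hxy
  | cons a x ih =>
    cases y with
    | nil => exact absurd List.nil_prefix hyx
    | cons b y =>
      simp only [List.map_cons, List.cons_lt_cons_iff, OrderDual.toDual_lt_toDual]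
      rcases lt_trichotomy a b with h | rfl | h
      · exact Or.inl (Or.inl h)
      · rw [List.prefix_cons_inj] at hxy hyx
        rcases ih hxy hyx with h | h
        · exact Or.inl (Or.inr ⟨rfl, h⟩)
        · exact Or.inr (Or.inr ⟨rfl, h⟩)
      · exact Or.inr (Or.inl h)

end Lists

/-! ### Preorders of the tree and the two ways to close the antidirected path. -/

section Cycles

variable {V : Type*} {D T : Digraph V} {r : V}

theorem IsOutTree.exists_interior (hT : IsOutTree T r) {a x : V} (h : IsAncestor T r a x)
    (hne : a ≠ x) : ∃ l, IsDipath T a x (a :: l ++ [x]) ∧ level T r a + l.length + 1 = level T r x ∧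
      ∀ v ∈ l, IsAncestor T r a v ∧ IsAncestor T r v x ∧ v ≠ a ∧ v ≠ x := by
  obtain ⟨l, hl, hlen, hmem⟩ := hT.exists_segment h
  rcases List.eq_nil_or_concat' l with rfl | ⟨l, b, rfl⟩
  · exact absurd (by simpa using hl.last) hne
  obtain rfl : b = x := by
    have := hl.last
    rw [← List.cons_append, List.getLast?_concat] at this
    exact Option.some.inj this
  refine ⟨l, hl, by simpa [← add_assoc] using hlen, fun v hv => ?_⟩
  obtain ⟨h1, h2, h3⟩ := hmem v (by simp [hv])
  refine ⟨h1, h2, h3, ?_⟩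
  rintro rfl
  exact (List.nodup_append.1 (List.nodup_cons.1 hl.nodup).2).2.2 v hv v (by simp) rfl

/-- A linear order, given by an injection `key`, in which the descendants of each vertex of `T` form
an interval that begins with this vertex. -/
structure IsPreorderKey {β : Type*} [LinearOrder β] (T : Digraph V) (r : V) (key : V → β) :
    Prop where
  injective : Function.Injective key
  mono : ∀ {a x}, IsAncestor T r a x → key a ≤ key x
  interval : ∀ {a v x}, IsAncestor T r a x → key a ≤ key v → key v ≤ key x → IsAncestor T r a v

theorem IsOutTree.isPreorderKey (hT : IsOutTree T r) {α : Type*} [LinearOrder α] {f : V → α}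
    (hf : Function.Injective f) : IsPreorderKey T r fun x => (rootPath T r x).map f := by
  have hpre : ∀ {a x}, IsAncestor T r a x ↔ (rootPath T r a).map f <+: (rootPath T r x).map f := by
    intro a x
    rw [hT.isAncestor_iff, List.prefix_map_iff_of_injective hf]
  refine ⟨fun x y h => hT.rootPath_injective (List.map_injective_iff.2 hf h), ?_, ?_⟩
  · intro a x h
    exact not_lt.1 (List.IsPrefix.le (hpre.1 h))
  · intro a v x h h1 h2
    exact hpre.2 (prefix_of_le_of_le (hpre.1 h) h1 h2)

variable {β : Type*} [LinearOrder β] {key : V → β} {k : ℕ}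

/-- With `z` the last common ancestor of `c₁` and `y₂`, the cycle is `c₂ ⇝ y₃ ← c₃ → y₂ ⇜ z ⇝ c₁ →
y₁ ← c₂`. The tree path `c₂ ⇝ y₃` is the long block. -/
theorem containsSubdivision_of_isAncestor (hT : IsOutTree T r) (hle : T ≤ D)
    (hkey : IsPreorderKey T r key) (hk : 1 ≤ k) {c₁ y₁ c₂ y₂ c₃ y₃ : V}
    (h₂₁ : D.Adj c₂ y₁) (h₃₂ : D.Adj c₃ y₂) (h₃₃ : D.Adj c₃ y₃) (h₁₁ : D.Adj c₁ y₁)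
    (n₂₂ : ¬ IsAncestor T r c₂ y₂) (n₃₂ : ¬ IsAncestor T r c₃ y₂) (n₃₃ : ¬ IsAncestor T r c₃ y₃)
    (k₁ : key c₁ < key c₂) (k₂ : key c₂ < key c₃) (k₃ : key c₃ < key y₃) (k₄ : key y₃ < key y₂)
    (k₅ : key y₂ < key y₁) (ha : IsAncestor T r c₂ y₃)
    (hlev : level T r c₂ + k ≤ level T r y₃) :
    ContainsSubdivision (blockCycle [k, 1, 1, 1, 1, 1]) D := by
  have hlt : ∀ {a x}, IsAncestor T r a x → a ≠ x → key a < key x := fun h hne =>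
    lt_of_le_of_ne (hkey.mono h) (hkey.injective.ne hne)
  have hpair : ∀ {a b}, D.Adj a b → key a < key b → IsDipath D a b [a, b] := fun h hlt =>
    isDipath_pair h fun e => hlt.ne (congrArg key e)
  obtain ⟨z, hz₁, hz₂, hmeet⟩ := hT.exists_meet c₁ y₂
  have kz := hkey.mono hz₁
  obtain ⟨l, hl, hlen, hlmem⟩ := hT.exists_interior ha (by rintro rfl; order)
  obtain ⟨m, hm, -, hmmem⟩ := hT.exists_interior hz₂ (by rintro rfl; order)
  obtain ⟨q, hq, -, hqmem⟩ := hT.exists_segment hz₁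
  have hlk : ∀ v ∈ l, key c₂ < key v ∧ key v < key y₃ ∧ v ≠ c₃ := by
    intro v hv
    obtain ⟨h1, h2, h3, h4⟩ := hlmem v hv
    exact ⟨hlt h1 h3.symm, hlt h2 h4, by rintro rfl; exact n₃₃ h2⟩
  have hmk : ∀ v ∈ m, key z < key v ∧ key v < key y₂ ∧ v ≠ c₃ ∧ v ≠ c₂ ∧ v ≠ y₃ := by
    intro v hv
    obtain ⟨h1, h2, h3, h4⟩ := hmmem v hv
    refine ⟨hlt h1 h3.symm, hlt h2 h4, ?_, ?_, ?_⟩ <;> rintro rfl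
    exacts [n₃₂ h2, n₂₂ h2, n₂₂ (hT.isAncestor_trans ha h2)]
  have hqk : ∀ v ∈ q, key z < key v ∧ key v ≤ key c₁ := by
    intro v hv
    obtain ⟨h1, h2, h3⟩ := hqmem v hv
    exact ⟨hlt h1 h3.symm, hkey.mono h2⟩
  -- A common vertex would make `c₂` an ancestor of `y₂`.
  have hlm : ∀ v ∈ l, v ∉ m := fun v hv hv' =>
    n₂₂ (hT.isAncestor_trans (hlmem v hv).1 (hmmem v hv').2.1)
  have hlq : ∀ v ∈ l, v ∉ q := fun v hv hv' => by
    have := (hlk v hv).1; have := (hqk v hv').2; order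
  have hmq : ∀ v ∈ m, v ∉ q := fun v hv hv' => by
    obtain ⟨h1, h2, h3, -⟩ := hmmem v hv
    exact h3 (hT.isAncestor_antisymm (hmeet v (hqmem v hv').2.1 h2) h1)
  refine containsSubdivision_blockCycle hk ![c₂, y₃, c₃, y₂, z, y₁] ![l, [], [], m, q, []]
    ?_ ?_ ?_ (by simp; omega) (hl.mono hle) (hpair h₃₃ k₃) (hpair h₃₂ (k₃.trans k₄))
    (hm.mono hle) ((hq.mono hle).concat h₁₁ ?_) (hpair h₂₁ (k₂.trans (k₃.trans (k₄.trans k₅))))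
  · rw [← List.nodup_ofFn]
    simp only [List.ofFn_succ, List.nodup_cons]
    simp
    refine ⟨⟨?_, ?_, ?_, ?_, ?_⟩, ⟨?_, ?_, ?_, ?_⟩, ⟨?_, ?_, ?_⟩, ⟨?_, ?_⟩, ?_⟩ <;> rintro rfl <;> order
  · simp only [Fin.forall_fin_succ]
    simp
    refine ⟨⟨?_, ?_, ?_⟩, ⟨?_, ?_, ?_⟩, ⟨?_, ?_, ?_⟩, ⟨?_, ?_, ?_⟩, ⟨?_, ?_, ?_⟩, ?_, ?_, ?_⟩ <;> intro h
    all_goals first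
      | (obtain ⟨h1, h2, h3⟩ := hlk _ h; first | exact h3 rfl | order)
      | (obtain ⟨h1, h2, h3, h4, h5⟩ := hmk _ h
         first | exact h3 rfl | exact h4 rfl | exact h5 rfl | order)
      | (obtain ⟨h1, h2⟩ := hqk _ h; order)
  · simp only [Fin.forall_fin_succ]
    simp
    exact ⟨⟨hlm, hlq⟩, ⟨fun v h h' => hlm v h' h, hmq⟩, fun v h h' => hlq v h' h,
      fun v h h' => hmq v h' h⟩
  · change y₁ ∉ z :: q
    intro h
    rcases List.mem_cons.1 h with rfl | h
    · order
    · obtain ⟨h1, h2⟩ := hqk _ h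
      order

/-- With `z` the last common ancestor of `c₁` and `y₃`, the cycle is `z ⇝ y₃ ← c₃ → y₂ ← c₂ → y₁ ←
c₁ ⇜ z`. The tree path `z ⇝ y₃` is the long block; it avoids `c₂` and `c₃`, which are not ancestors
of `y₃`. -/
theorem containsSubdivision_of_not_isAncestor (hT : IsOutTree T r) (hle : T ≤ D)
    (hkey : IsPreorderKey T r key) (hk : 1 ≤ k) {c₁ y₁ c₂ y₂ c₃ y₃ : V}
    (h₁₁ : D.Adj c₁ y₁) (h₂₁ : D.Adj c₂ y₁) (h₂₂ : D.Adj c₂ y₂) (h₃₂ : D.Adj c₃ y₂)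
    (h₃₃ : D.Adj c₃ y₃) (n₃₃ : ¬ IsAncestor T r c₃ y₃)
    (k₁ : key c₁ < key c₂) (k₂ : key c₂ < key c₃) (k₃ : key c₃ < key y₃) (k₄ : key y₃ < key y₂)
    (k₅ : key y₂ < key y₁) (ha : ¬ IsAncestor T r c₂ y₃)
    (hlev : level T r c₃ + k ≤ level T r y₃) :
    ContainsSubdivision (blockCycle [k, 1, 1, 1, 1, 1]) D := by
  have hlt : ∀ {a x}, IsAncestor T r a x → a ≠ x → key a < key x := fun h hne =>
    lt_of_le_of_ne (hkey.mono h) (hkey.injective.ne hne)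
  have hpair : ∀ {a b}, D.Adj a b → key a < key b → IsDipath D a b [a, b] := fun h hlt =>
    isDipath_pair h fun e => hlt.ne (congrArg key e)
  obtain ⟨z, hz₁, hz₂, hmeet⟩ := hT.exists_meet c₁ y₃
  have kz := hkey.mono hz₁
  -- In the preorder `c₃` lies between `z` and its descendant `y₃`, so it descends from `z`; the
  -- level gap from `c₃` to `y₃` thus bounds the length of `z ⇝ y₃`.
  have hz₃ : level T r z ≤ level T r c₃ :=
    hT.level_le (hkey.interval hz₂ (by order) (by order))
  obtain ⟨l, hl, hlen, hlmem⟩ := hT.exists_interior hz₂ (by rintro rfl; order)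
  obtain ⟨q, hq, -, hqmem⟩ := hT.exists_segment hz₁
  have hlk : ∀ v ∈ l, key z < key v ∧ key v < key y₃ ∧ v ≠ c₃ ∧ v ≠ c₂ := by
    intro v hv
    obtain ⟨h1, h2, h3, h4⟩ := hlmem v hv
    refine ⟨hlt h1 h3.symm, hlt h2 h4, ?_, ?_⟩ <;> rintro rfl
    exacts [n₃₃ h2, ha h2]
  have hqk : ∀ v ∈ q, key z < key v ∧ key v ≤ key c₁ := by
    intro v hv
    obtain ⟨h1, h2, h3⟩ := hqmem v hv
    exact ⟨hlt h1 h3.symm, hkey.mono h2⟩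
  have hlq : ∀ v ∈ l, v ∉ q := fun v hv hv' => by
    obtain ⟨h1, h2, h3, -⟩ := hlmem v hv
    exact h3 (hT.isAncestor_antisymm (hmeet v (hqmem v hv').2.1 h2) h1)
  refine containsSubdivision_blockCycle hk ![z, y₃, c₃, y₂, c₂, y₁] ![l, [], [], [], [], q]
    ?_ ?_ ?_ (by simp; omega) (hl.mono hle) (hpair h₃₃ k₃) (hpair h₃₂ (k₃.trans k₄))
    (hpair h₂₂ (k₂.trans (k₃.trans k₄)))
    (hpair h₂₁ (k₂.trans (k₃.trans (k₄.trans k₅)))) ((hq.mono hle).concat h₁₁ ?_)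
  · rw [← List.nodup_ofFn]
    simp only [List.ofFn_succ, List.nodup_cons]
    simp
    refine ⟨⟨?_, ?_, ?_, ?_, ?_⟩, ⟨?_, ?_, ?_, ?_⟩, ⟨?_, ?_, ?_⟩, ⟨?_, ?_⟩, ?_⟩ <;> rintro rfl <;> order
  · simp only [Fin.forall_fin_succ]
    simp
    refine ⟨⟨?_, ?_⟩, ⟨?_, ?_⟩, ⟨?_, ?_⟩, ⟨?_, ?_⟩, ⟨?_, ?_⟩, ?_, ?_⟩ <;> intro h
    all_goals first
      | (obtain ⟨h1, h2, h3, h4⟩ := hlk _ h; first | exact h3 rfl | exact h4 rfl | order)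
      | (obtain ⟨h1, h2⟩ := hqk _ h; order)
  · simp only [Fin.forall_fin_succ]
    simp
    exact ⟨hlq, fun v h h' => hlq v h' h⟩
  · change y₁ ∉ z :: q
    intro h
    rcases List.mem_cons.1 h with rfl | h
    · order
    · obtain ⟨h1, h2⟩ := hqk _ h
      order

end Cycles

/-! ### Arcs of `D_i^3` and their number. -/

section ClassDigraph

variable {V : Type*} {D T : Digraph V} {r : V} {k i : ℕ}

/-- Levels in one class are congruent modulo `k`; this is what makes a block long. -/
theorem level_add_le_of_mem_levelClass {x y : V} (hx : x ∈ levelClass T r k i)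
    (hy : y ∈ levelClass T r k i) (h : level T r x < level T r y) :
    level T r x + k ≤ level T r y := by
  obtain ⟨a, ha⟩ := hx
  obtain ⟨b, hb⟩ := hy
  rw [ha, hb] at h ⊢
  have hab : a + 1 ≤ b := lt_of_mul_lt_mul_right (Nat.lt_of_add_lt_add_left h) (Nat.zero_le k)
  have := Nat.mul_le_mul_right k hab
  linarith

theorem classDigraph₃_adj (hD : IsOriented D) (hT : IsOutTree T r) (hfinal : IsFinal D T r)
    {x y : levelClass T r k i} (h : (classDigraph₃ D T r k i).Adj x y) :
    D.Adj x y ∧ ¬ IsAncestor T r x y ∧ level T r x < level T r y := by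
  obtain ⟨hxy, hn⟩ := h
  rw [not_or] at hn
  have hadj : D.Adj x y := hxy
  have hlt : level T r x < level T r y := by
    by_contra hlt
    have hyx := hfinal x y hadj hlt
    rcases (not_lt.1 hlt).lt_or_eq with h | h
    · exact hn.2 ⟨hxy, h, hyx⟩
    · have := hT.eq_of_level_le hyx h.ge
      rw [this] at hadj
      exact hD _ _ hadj hadj
  exact ⟨hadj, fun ha => hn.1 ⟨hxy, hlt, ha⟩, hlt⟩

open Finset in
theorem card_classDigraph₃_arcs_le (hk : 1 ≤ k) (hD : IsOriented D)
    (hfree : ¬ ContainsSubdivision (blockCycle [k, 1, 1, 1, 1, 1]) D) (hT : IsOutTree T r)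
    (hle : T ≤ D) (hfinal : IsFinal D T r) {β : Type*} [LinearOrder β] {key : V → β}
    (hkey : IsPreorderKey T r key) {S : Finset (levelClass T r k i)}
    {A : Finset (levelClass T r k i × levelClass T r k i)} (hAS : A ⊆ S ×ˢ S)
    (hA : ∀ p ∈ A, (classDigraph₃ D T r k i).Adj p.1 p.2 ∧ key p.1 < key p.2) :
    #A ≤ 4 * #S := by
  classical
  by_contra! hcard
  obtain ⟨c₁, y₁, c₂, y₂, c₃, y₃, h₁₁, h₂₁, h₂₂, h₃₂, h₃₃, k₁, k₂, k₄, k₅⟩ :=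
    exists_nested_antidirected_path (key := fun x : levelClass T r k i => key x)
      (hkey.injective.comp Subtype.val_injective) hAS hcard
  replace h₁₁ := hA _ h₁₁
  replace h₂₁ := hA _ h₂₁
  replace h₂₂ := hA _ h₂₂
  replace h₃₂ := hA _ h₃₂
  replace h₃₃ := hA _ h₃₃
  obtain ⟨a₁₁, -⟩ := classDigraph₃_adj hD hT hfinal h₁₁.1
  obtain ⟨a₂₁, -⟩ := classDigraph₃_adj hD hT hfinal h₂₁.1
  obtain ⟨a₂₂, n₂₂, -⟩ := classDigraph₃_adj hD hT hfinal h₂₂.1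
  obtain ⟨a₃₂, n₃₂, -⟩ := classDigraph₃_adj hD hT hfinal h₃₂.1
  obtain ⟨a₃₃, n₃₃, hlev⟩ := classDigraph₃_adj hD hT hfinal h₃₃.1
  apply hfree
  by_cases ha : IsAncestor T r c₂ y₃
  · have hlt : level T r c₂ < level T r y₃ := by
      by_contra hlt
      have := congrArg key (hT.eq_of_level_le ha (not_lt.1 hlt))
      exact absurd this (k₂.trans h₃₃.2).ne
    exact containsSubdivision_of_isAncestor hT hle hkey hk a₂₁ a₃₂ a₃₃ a₁₁ n₂₂ n₃₂ n₃₃ k₁ k₂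
      h₃₃.2 k₄ k₅ ha (level_add_le_of_mem_levelClass c₂.2 y₃.2 hlt)
  · exact containsSubdivision_of_not_isAncestor hT hle hkey hk a₁₁ a₂₁ a₂₂ a₃₂ a₃₃ n₃₃ k₁ k₂
      h₃₃.2 k₄ k₅ ha (level_add_le_of_mem_levelClass c₃.2 y₃.2 hlev)

end ClassDigraph

end SixBlocks

theorem propositionp3 {V : Type*} [Finite V] (k : ℕ) (D T : Digraph V) (r : V)
    (hD : SixBlocks.IsOriented D)
    (hfree : ¬ SixBlocks.ContainsSubdivision (SixBlocks.blockCycle [k, 1, 1, 1, 1, 1]) D)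
    (hT : SixBlocks.IsSpanningOutTree D T r)
    (hfinal : SixBlocks.IsFinal D T r) :
    ∀ i : ℕ, 1 ≤ i → i ≤ k → SixBlocks.chi (SixBlocks.classDigraph₃ D T r k i) ≤ 24 := by
  classical
  intro i hi hik
  have hk : 1 ≤ k := hi.trans hik
  obtain ⟨hT, hle⟩ := hT
  obtain ⟨n, ⟨e⟩⟩ := Finite.exists_equiv_fin V
  -- An arbitrary numbering of the vertices orders siblings; its dual gives the reversed preorder.
  have hkey₁ := hT.isPreorderKey (f := e) e.injective
  have hkey₂ := hT.isPreorderKey (f := OrderDual.toDual ∘ e)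
    (OrderDual.toDual.injective.comp e.injective)
  -- Here `8 = 4 + 4`, one bound for each preorder.
  have hcol : (SixBlocks.classDigraph₃ D T r k i).toSimpleGraphInclusive.Colorable (2 * 8 + 1) := by
    refine SixBlocks.colorable_of_card_arcs_le (SixBlocks.classDigraph₃ D T r k i).Adj
      (fun v w h => ?_) 8 fun S => ?_
    · rw [Digraph.toSimpleGraphInclusive, SimpleGraph.fromRel_adj] at h
      exact h.2
    · set E := {p ∈ S ×ˢ S | (SixBlocks.classDigraph₃ D T r k i).Adj p.1 p.2}
      have hES : E ⊆ S ×ˢ S := Finset.filter_subset _ _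
      have hE : ∀ p ∈ E, (SixBlocks.classDigraph₃ D T r k i).Adj p.1 p.2 := fun p hp =>
        (Finset.mem_filter.1 hp).2
      have h₁ := SixBlocks.card_classDigraph₃_arcs_le hk hD hfree hT hle hfinal hkey₁
        ((Finset.filter_subset _ _).trans hES) fun p hp =>
          ⟨hE p (Finset.mem_filter.1 hp).1, (Finset.mem_filter.1 hp).2⟩
      have h₂ := SixBlocks.card_classDigraph₃_arcs_le hk hD hfree hT hle hfinal hkey₂
        ((Finset.filter_subset _ _).trans hES) fun p hp =>
          ⟨hE p (Finset.mem_filter.1 hp).1, (Finset.mem_filter.1 hp).2⟩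
      refine (Finset.card_le_card fun p hp => ?_).trans
        ((Finset.card_union_le _ _).trans ((add_le_add h₁ h₂).trans (by omega)))
      obtain ⟨-, hn, hlt⟩ := SixBlocks.classDigraph₃_adj hD hT hfinal (hE p hp)
      have hn' : ¬ SixBlocks.IsAncestor T r p.2 p.1 := fun h => (hT.level_le h).not_gt hlt
      rw [hT.isAncestor_iff, ← List.prefix_map_iff_of_injective e.injective] at hn hn'
      rcases SixBlocks.lt_or_map_toDual_lt hn hn' with h | h
      · exact Finset.mem_union_left _ (Finset.mem_filter.2 ⟨hp, h⟩)
      · refine Finset.mem_union_right _ (Finset.mem_filter.2 ⟨hp, ?_⟩)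
        simpa only [List.map_map] using h
  exact hcol.chromaticNumber_le.trans (by norm_num)
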